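/- Let $(V,E)$ be a finite undirected graph with neighborhoods $N(i)$ and set of directed edges $\vec E=\{(i,j): i,j \text{ adjacent}\}$. Let $\Gamma\in\mathbb R^{V\times V}$ be symmetric positive definite with $\Gamma_{ii}=1$ for all $i$ and $\Gamma_{ij}\ne0$ for every edge $(i,j)$, let $h\in\mathbb R^V$, and let $f(x)=\tfrac12x^\top\Gamma x-h^\top x$. A *decomposition* of $f$ is a family of quadratic functions $\{f_i,f_{ij}\}$ (polynomials of degree at most two, with $f_{ij}(x_i,x_j)=f_{ji}(x_j,x_i)$) such that $f(x)=\sum_{i\in V}f_i(x_i)+\sum_{(i,j)\in E}f_{ij}(x_i,x_j)$ for all $x$. It is *convex* if every $f_i$ is strictly convex and every $f_{ij}$ is convex. It is *convex-dominated* if there is a convex decomposition $\{g_i,g_{ij}\}$ of $f$ such that $g_{ij}-f_{ij}$ is convex for every edge $(i,j)$. Up to additive constants, components can be written with quadratic parameters $\gamma=(\gamma_{ij})_{(i,j)\in\vec E}$ and linear parameters $z=(z_{ij})_{(i,j)\in\vec E}$ as $$f_{ij}(x_i,x_j)=\tfrac12\left(\gamma_{ji}\Gamma_{ij}^2x_i^2+2\Gamma_{ij}x_ix_j+\gamma_{ij}\Gamma_{ij}^2x_j^2\right)-z_{ji}x_i-z_{ij}x_j,$$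 $$f_j(x_j)=\tfrac12\Big(1-\sum_{i\in N(j)}\Gamma_{ij}^2\gamma_{ij}\Big)x_j^2-\Big(h_j-\sum_{i\in N(j)}z_{ij}\Big)x_j.$$ Given initial components $\{f^{(0)}_i,f^{(0)}_{ij}\}$, the synchronous min-sum algorithm is, with arbitrary additive constants $\kappa$ that may differ at each occurrence and each time, $$f_i^{(t+1)}(x_i)=\kappa+f_i^{(t)}(x_i)+\sum_{j\in N(i)}\min_{x_j}\big(f_j^{(t)}(x_j)+f_{ij}^{(t)}(x_i,x_j)\big),$$ $$f_{ij}^{(t+1)}(x_i,x_j)=\kappa+f_{ij}^{(t)}(x_i,x_j)-\min_{y_i}\big(f_i^{(t)}(y_i)+f_{ij}^{(t)}(y_i,x_j)\big)-\min_{y_j}\big(f_j^{(t)}(y_j)+f_{ij}^{(t)}(x_i,y_j)\big),$$ with running estimates $x_j^{(t)}=\arg\min_{y}f_j^{(t)}(y)$. **Theorem (Quadratic Min-Sum Convergence).** Suppose that $f$ has a convex decomposition and that $\{f^{(0)}_i,f^{(0)}_{ij}\}$ is a convex-dominated decomposition of $f$. Then all minimizations in the algorithm are attained at every time, each iterate $\{f_i^{(t)},f_{ij}^{(t)}\}$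 has parameters $\gamma^{(t)},z^{(t)}$ as above up to additive constants, each $x_j^{(t)}$ is the unique minimizer of $f_j^{(t)}$, the sequences $\gamma^{(t)}$, $z^{(t)}$ and $x^{(t)}$ converge as $t\to\infty$, and $$\lim_{t\to\infty}f(x^{(t)})=\min_xf(x).$$ **Totally asynchronous extension.** Let $\gamma^{(0)},z^{(0)}$ be the parameters of the same initial decomposition. For each $i\in V$ let $T^i\subseteq\mathbb N$ be an infinite set of update times, and for each $(u,i)\in\vec E$ let $0\le\tau_{ui}(t)\le t$ be such that $\tau_{ui}(t)\to\infty$ as $t\to\infty$ along $t\in T^i$. For $(i,j)\in\vec E$ put $d_{ij}(t)=1-\sum_{u\in N(i)\setminus j}\Gamma_{ui}^2\gamma_{ui}^{(\tau_{ui}(t))}$. If $t\in T^i$ let $$\gamma_{ij}^{(t+1)}=\frac1{d_{ij}(t)},\qquad z_{ij}^{(t+1)}=\frac{\Gamma_{ij}}{d_{ij}(t)}\Big(h_i-\sum_{u\in N(i)\setminus j}z_{ui}^{(\tau_{ui}(t))}\Big),$$ and if $t\notin T^i$ let $\gamma^{(t+1)}_{ij}=\gamma^{(t)}_{ij}$,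 $z^{(t+1)}_{ij}=z^{(t)}_{ij}$. Let $$x_j^{(t)}=\frac{1}{1-\sum_{i\in N(j)}\Gamma_{ij}^2\gamma_{ij}^{(t)}}\Big(h_j-\sum_{i\in N(j)}z_{ij}^{(t)}\Big).$$ Then $d_{ij}(t)>0$ for all $(i,j)\in\vec E$ and $t\in T^i$, $\sum_{i\in N(j)}\Gamma_{ij}^2\gamma_{ij}^{(t)}<1$ for all $j$ and $t$, the sequences $\gamma^{(t)}$, $z^{(t)}$ and $x^{(t)}$ converge, and $\lim_{t\to\infty}f(x^{(t)})=\min_xf(x)$. -/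

import Mathlib

open Filter Topology

namespace MinSum

noncomputable section

/-- The objective `f(x) = ½ xᵀ Γ x - hᵀ x`. -/
def objective {V : Type*} [Fintype V] (Γ : Matrix V V ℝ) (h : V → ℝ) (x : V → ℝ) : ℝ :=
  1 / 2 * (x ⬝ᵥ Γ.mulVec x) - h ⬝ᵥ x

/-- A quadratic function of one real variable (a polynomial of degree at most two). -/
def IsQuadratic₁ (φ : ℝ → ℝ) : Prop :=
  ∃ a b c : ℝ, ∀ x, φ x = a * x ^ 2 + b * x + c

/-- A quadratic function of two real variables (a polynomial of total degree at most two). -/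
def IsQuadratic₂ (φ : ℝ → ℝ → ℝ) : Prop :=
  ∃ a b c d e k : ℝ, ∀ x y, φ x y = a * x ^ 2 + b * (x * y) + c * y ^ 2 + d * x + e * y + k

/-- Single-vertex functions `f_i(x_i)` and pairwise functions `f_{ij}(x_i, x_j)`.
Only `edge i j` with `i`, `j` adjacent is ever used; the function of the undirected edge
`(i, j)` is seen from `i` as `edge i j` and from `j` as `edge j i`. -/
structure Components (V : Type*) where
  vertex : V → ℝ → ℝ
  edge : V → V → ℝ → ℝ → ℝ

variable {V : Type*} [Fintype V] [DecidableEq V]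

/-- `∑_{i ∈ V} f_i(x_i) + ∑_{(i,j) ∈ E} f_{ij}(x_i, x_j)`; the double sum over ordered adjacent
pairs meets every undirected edge twice, whence the factor `1 / 2`. -/
def Components.total (G : SimpleGraph V) [DecidableRel G.Adj] (D : Components V)
    (x : V → ℝ) : ℝ :=
  ∑ i, D.vertex i (x i) + 1 / 2 * ∑ i, ∑ j ∈ G.neighborFinset i, D.edge i j (x i) (x j)

/-- The components are quadratic, the pairwise functions are indexed by undirected edges, and
they all sum to `f`. -/
structure IsQuadraticDecomposition (G : SimpleGraph V) [DecidableRel G.Adj] (f : (V → ℝ) → ℝ)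
    (D : Components V) : Prop where
  quadratic_vertex : ∀ i, IsQuadratic₁ (D.vertex i)
  quadratic_edge : ∀ i j, G.Adj i j → IsQuadratic₂ (D.edge i j)
  edge_symm : ∀ i j, G.Adj i j → ∀ x y, D.edge i j x y = D.edge j i y x
  sum_eq : ∀ x, f x = D.total G x

/-- A convex decomposition: strictly convex vertex functions, convex pairwise functions. -/
structure IsConvexDecomposition (G : SimpleGraph V) [DecidableRel G.Adj] (f : (V → ℝ) → ℝ)
    (D : Components V) : Prop extends IsQuadraticDecomposition G f D where
  strictConvex_vertex : ∀ i, StrictConvexOn ℝ Set.univ (D.vertex i)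
  convex_edge : ∀ i j, G.Adj i j → ConvexOn ℝ Set.univ (fun p : ℝ × ℝ => D.edge i j p.1 p.2)

/-- `f` admits a convex decomposition. -/
def ConvexDecomposable (G : SimpleGraph V) [DecidableRel G.Adj] (f : (V → ℝ) → ℝ) : Prop :=
  ∃ D : Components V, IsConvexDecomposition G f D

/-- A quadratic decomposition whose pairwise functions are dominated, up to a convex difference,
by those of some convex decomposition. -/
def IsConvexDominated (G : SimpleGraph V) [DecidableRel G.Adj] (f : (V → ℝ) → ℝ)
    (D : Components V) : Prop :=
  IsQuadraticDecomposition G f D ∧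
    ∃ C : Components V, IsConvexDecomposition G f C ∧
      ∀ i j, G.Adj i j →
        ConvexOn ℝ Set.univ (fun p : ℝ × ℝ => C.edge i j p.1 p.2 - D.edge i j p.1 p.2)

/-- `min_{y_i} (f_i(y_i) + f_{ij}(y_i, x_j))`, as a function of `x_j`.  It is a genuine minimum
when `WellPosed` holds. -/
def Components.partialMin (D : Components V) (i j : V) (xj : ℝ) : ℝ :=
  ⨅ yi : ℝ, (D.vertex i yi + D.edge i j yi xj)

/-- All the minimizations that the update performs are attained. -/
def Components.WellPosed (G : SimpleGraph V) (D : Components V) : Prop :=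
  ∀ i j, G.Adj i j → ∀ xj : ℝ, ∃ yi : ℝ, ∀ yi' : ℝ,
    D.vertex i yi + D.edge i j yi xj ≤ D.vertex i yi' + D.edge i j yi' xj

/-- One synchronous min-sum update of the components, with additive offsets `κv`, `κe`. -/
def Components.step (G : SimpleGraph V) [DecidableRel G.Adj] (κv : V → ℝ) (κe : Sym2 V → ℝ)
    (D : Components V) : Components V where
  vertex i x := κv i + D.vertex i x + ∑ j ∈ G.neighborFinset i, D.partialMin j i x
  edge i j x y := κe s(i, j) + D.edge i j x y - D.partialMin i j y - D.partialMin j i x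

/-- The min-sum iterates `f^{(t)}` started from `D`, with arbitrary offsets at each time. -/
def Components.iterates (G : SimpleGraph V) [DecidableRel G.Adj] (κv : ℕ → V → ℝ)
    (κe : ℕ → Sym2 V → ℝ) (D : Components V) : ℕ → Components V
  | 0 => D
  | t + 1 => (Components.iterates G κv κe D t).step G (κv t) (κe t)

/-- `γ` (quadratic) and `z` (linear) are the parameters of the components `D`, up to constant
offsets.  Only their values on directed edges matter. -/
def HasParameters (G : SimpleGraph V) [DecidableRel G.Adj] (Γ : Matrix V V ℝ) (h : V → ℝ)
    (D : Components V) (γ z : V → V → ℝ) : Prop :=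
  (∀ j, ∃ c : ℝ, ∀ x, D.vertex j x =
      1 / 2 * (1 - ∑ i ∈ G.neighborFinset j, Γ i j ^ 2 * γ i j) * x ^ 2
        - (h j - ∑ i ∈ G.neighborFinset j, z i j) * x + c) ∧
    ∀ i j, G.Adj i j → ∃ c : ℝ, ∀ x y, D.edge i j x y =
      1 / 2 * (γ j i * Γ i j ^ 2 * x ^ 2 + 2 * Γ i j * x * y + γ i j * Γ i j ^ 2 * y ^ 2)
        - z j i * x - z i j * y + c

/-- Total asynchronism.  `T i` is the set of times at which vertex `i` updates, and `τ u i t ≤ t`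
is the last time, as of time `t`, at which `u` communicated to `i`.  Every vertex updates
infinitely often, and along its update times `τ u i t` tends to infinity for each neighbor `u`. -/
structure TotallyAsynchronous (G : SimpleGraph V) (T : V → Set ℕ) (τ : V → V → ℕ → ℕ) :
    Prop where
  delay_le : ∀ u i t, G.Adj u i → τ u i t ≤ t
  infinite : ∀ i, (T i).Infinite
  tendsto : ∀ u i, G.Adj u i → Tendsto (τ u i) (atTop ⊓ 𝓟 (T i)) atTop

/-- `1 - ∑_{u ∈ N(i) \ j} Γ_{ui}² γ_{ui}^{(τ_{ui}(t))}`, the denominator in the asynchronous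
updates of the parameters of the directed edge from `i` to `j`. -/
def asyncDenom (G : SimpleGraph V) [DecidableRel G.Adj] (Γ : Matrix V V ℝ)
    (τ : V → V → ℕ → ℕ) (γ : ℕ → V → V → ℝ) (t : ℕ) (i j : V) : ℝ :=
  1 - ∑ u ∈ (G.neighborFinset i).erase j, Γ u i ^ 2 * γ (τ u i t) u i

/-- The asynchronous evolution of the parameters. -/
structure IsAsyncRun (G : SimpleGraph V) [DecidableRel G.Adj] (Γ : Matrix V V ℝ) (h : V → ℝ)
    (T : V → Set ℕ) (τ : V → V → ℕ → ℕ) (γ z : ℕ → V → V → ℝ) : Prop where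
  quadratic_update : ∀ t i j, G.Adj i j → t ∈ T i →
    γ (t + 1) i j = 1 / asyncDenom G Γ τ γ t i j
  linear_update : ∀ t i j, G.Adj i j → t ∈ T i →
    z (t + 1) i j = Γ i j * (h i - ∑ u ∈ (G.neighborFinset i).erase j, z (τ u i t) u i)
      / asyncDenom G Γ τ γ t i j
  idle : ∀ t i j, G.Adj i j → t ∉ T i → γ (t + 1) i j = γ t i j ∧ z (t + 1) i j = z t i j

/-- The quadratic parameters, linear parameters and estimates all converge. -/
def ParametersConverge (G : SimpleGraph V) (γ z : ℕ → V → V → ℝ) (x : ℕ → V → ℝ) : Prop :=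
  (∃ γlim : V → V → ℝ, ∀ i j, G.Adj i j → Tendsto (fun t => γ t i j) atTop (𝓝 (γlim i j))) ∧
  (∃ zlim : V → V → ℝ, ∀ i j, G.Adj i j → Tendsto (fun t => z t i j) atTop (𝓝 (zlim i j))) ∧
  ∃ xlim : V → ℝ, Tendsto x atTop (𝓝 xlim)

/-- `lim f(x^{(t)}) = min f`, the minimum being attained. -/
def AttainsMinInLimit (f : (V → ℝ) → ℝ) (x : ℕ → V → ℝ) : Prop :=
  ∃ m : ℝ, IsLeast (Set.range f) m ∧ Tendsto (fun t => f (x t)) atTop (𝓝 m)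

end

end MinSum

namespace MinSum

variable {V : Type*} [Fintype V] [DecidableEq V]

/-! On the parameters the algorithm is an iteration over directed edges: γ is replaced by F(γ), with
F(γ)_{ij} the inverse of `updateDenom`, and z by an affine image of itself whose coefficients depend
on γ. The synchronous algorithm is the case without delays in which every vertex always updates, so
only the asynchronous run needs a convergence proof.

F is monotone below a convex parameter v, and convexity of the decomposition forces F(v) < v. Hence
iteration from 0 increases to a fixed point γ* strictly below every convex parameter
(`exists_fixedPoint`), and from any γ ≤ v, where a convex-dominated start lies, F contracts towards
γ* in the maximum norm with weights v - γ*.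

For z, a convex parameter makes I - |Γ - I| positive definite, which gives d > 0 with ∑ |Γ_ij| d_j <
d_i (`exists_dominant`). Such a d defines another convex parameter; γ* lies below it too, and the
gap supplies weights in which the linear update at γ* contracts (`exists_linear_weights`). That γ is
still moving is a vanishing perturbation.

`TotallyAsynchronous.tendsto_zero` turns both contractions into convergence. The limit of z is
explicit in the solution of Γ x = h, whence the estimates converge to that solution, the minimizer
of f. -/

/-- `1 - ∑_{u ∈ N(i) \ j} Γ_{ui}² γ_{ui}`, the denominator of the update at `(i, j)`. -/
noncomputable def updateDenom (G : SimpleGraph V) [DecidableRel G.Adj] (Γ : Matrix V V ℝ)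
    (γ : V → V → ℝ) (i j : V) : ℝ :=
  1 - ∑ u ∈ (G.neighborFinset i).erase j, Γ u i ^ 2 * γ u i

/-- `v` is the vector of quadratic parameters of some convex decomposition. -/
structure IsConvexParameter (G : SimpleGraph V) [DecidableRel G.Adj] (Γ : Matrix V V ℝ)
    (v : V → V → ℝ) : Prop where
  pos : ∀ i j, G.Adj i j → 0 < v i j
  one_le : ∀ i j, G.Adj i j → 1 ≤ Γ i j ^ 2 * v i j * v j i
  sum_lt : ∀ j, ∑ i ∈ G.neighborFinset j, Γ i j ^ 2 * v i j < 1

/-! ### The quadratic update: monotonicity, fixed point, contraction -/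

section FixedPoint

variable {G : SimpleGraph V} [DecidableRel G.Adj] {Γ : Matrix V V ℝ} {v : V → V → ℝ}

lemma updateDenom_anti {γ γ' : V → V → ℝ} (hle : ∀ i j, G.Adj i j → γ i j ≤ γ' i j) (i j : V) :
    updateDenom G Γ γ' i j ≤ updateDenom G Γ γ i j := by
  unfold updateDenom
  refine sub_le_sub_left (Finset.sum_le_sum fun u hu => ?_) _
  have hu' : G.Adj u i := by
    simpa using (((G.mem_neighborFinset i u).1 (Finset.mem_of_mem_erase hu))).symm
  exact mul_le_mul_of_nonneg_left (hle u i hu') (sq_nonneg _)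

lemma updateDenom_eq_of_adj {γ : V → V → ℝ} {i j : V} (hij : G.Adj i j) :
    updateDenom G Γ γ i j =
      1 - ∑ u ∈ G.neighborFinset i, Γ u i ^ 2 * γ u i + Γ j i ^ 2 * γ j i := by
  have := Finset.add_sum_erase (G.neighborFinset i) (fun u => Γ u i ^ 2 * γ u i)
    ((G.mem_neighborFinset i j).2 hij)
  unfold updateDenom
  linarith

lemma IsConvexParameter.updateDenom_gt (hv : IsConvexParameter G Γ v) {i j : V}
    (hij : G.Adj i j) : Γ j i ^ 2 * v j i < updateDenom G Γ v i j := by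
  rw [updateDenom_eq_of_adj hij]
  linarith [hv.sum_lt i]

lemma IsConvexParameter.updateDenom_pos (hv : IsConvexParameter G Γ v) {γ : V → V → ℝ}
    (hle : ∀ i j, G.Adj i j → γ i j ≤ v i j) {i j : V} (hij : G.Adj i j) :
    0 < updateDenom G Γ γ i j := by
  have h1 := updateDenom_anti (Γ := Γ) hle i j
  have h2 := hv.updateDenom_gt hij
  have h3 := mul_nonneg (sq_nonneg (Γ j i)) (hv.pos j i hij.symm).le
  linarith

/-- The denominator exceeds Γ_ji² v_ji because the vertex coefficient at i is positive, and Γ_ji²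
v_ji ≥ 1 / v_ij because the edge form is positive semidefinite. So v is a strict supersolution of
the fixed-point equation. -/
lemma IsConvexParameter.update_lt (hv : IsConvexParameter G Γ v) {i j : V}
    (hij : G.Adj i j) : 1 / updateDenom G Γ v i j < v i j := by
  have h2 := hv.updateDenom_gt hij
  have h0 := hv.updateDenom_pos (fun _ _ _ => le_rfl) hij
  have h1 := hv.one_le j i hij.symm
  rw [div_lt_iff₀ h0]
  nlinarith [mul_lt_mul_of_pos_left h2 (hv.pos i j hij)]

lemma IsConvexParameter.update_mono (hv : IsConvexParameter G Γ v) {γ γ' : V → V → ℝ}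
    (hle : ∀ i j, G.Adj i j → γ i j ≤ γ' i j) (hle' : ∀ i j, G.Adj i j → γ' i j ≤ v i j)
    {i j : V} (hij : G.Adj i j) :
    1 / updateDenom G Γ γ i j ≤ 1 / updateDenom G Γ γ' i j :=
  one_div_le_one_div_of_le (hv.updateDenom_pos hle' hij) (updateDenom_anti hle i j)

/-- The quadratic parameters have a fixed point lying strictly below every convex parameter. -/
lemma exists_fixedPoint (hex : ∃ v, IsConvexParameter G Γ v) :
    ∃ γs : V → V → ℝ, (∀ i j, G.Adj i j → γs i j = 1 / updateDenom G Γ γs i j) ∧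
      ∀ v, IsConvexParameter G Γ v → ∀ i j, G.Adj i j → γs i j < v i j := by
  obtain ⟨v, hv⟩ := hex
  let F : (V → V → ℝ) → V → V → ℝ := fun γ i j => 1 / updateDenom G Γ γ i j
  -- The sequence starts at 0 and does not involve v, so a single limit serves for all convex
  -- parameters at once.
  let a : ℕ → V → V → ℝ := fun n => F^[n] 0
  have ha : ∀ n, a (n + 1) = F (a n) := fun n => Function.iterate_succ_apply' F n 0
  have hb : ∀ v, IsConvexParameter G Γ v → ∀ n i j, G.Adj i j → a n i j ≤ v i j := by
    intro v hv n
    induction n with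
    | zero => intro i j hij; exact (hv.pos i j hij).le
    | succ n ih =>
      intro i j hij
      rw [ha]
      exact (hv.update_mono ih (fun _ _ _ => le_rfl) hij).trans (hv.update_lt hij).le
  have hm : ∀ n i j, G.Adj i j → a n i j ≤ a (n + 1) i j := by
    intro n
    induction n with
    | zero =>
      intro i j hij
      rw [ha]
      exact (one_div_pos.2 (hv.updateDenom_pos (hb v hv 0) hij)).le
    | succ n ih =>
      intro i j hij
      rw [ha (n + 1), ha n]
      have := hv.update_mono ih (hb v hv (n + 1)) hij
      rw [ha n] at this
      exact this
  have hlim : ∀ i j, G.Adj i j → Tendsto (fun n => a n i j) atTop (𝓝 (⨆ n, a n i j)) :=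
    fun i j hij => tendsto_atTop_ciSup (monotone_nat_of_le_succ fun n => hm n i j hij)
      ⟨v i j, by rintro _ ⟨n, rfl⟩; exact hb v hv n i j hij⟩
  let γs : V → V → ℝ := fun i j => ⨆ n, a n i j
  have hle : ∀ v, IsConvexParameter G Γ v → ∀ i j, G.Adj i j → γs i j ≤ v i j :=
    fun v hv i j hij => le_of_tendsto' (hlim i j hij) fun n => hb v hv n i j hij
  have hfix : ∀ i j, G.Adj i j → γs i j = 1 / updateDenom G Γ γs i j := by
    intro i j hij
    have h1 : Tendsto (fun n => a (n + 1) i j) atTop (𝓝 (γs i j)) :=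
      (hlim i j hij).comp (tendsto_add_atTop_nat 1)
    have h2 : Tendsto (fun n => a (n + 1) i j) atTop (𝓝 (1 / updateDenom G Γ γs i j)) := by
      simp only [ha]
      refine tendsto_const_nhds.div ?_ (hv.updateDenom_pos (hle v hv) hij).ne'
      refine tendsto_const_nhds.sub (tendsto_finsetSum _ fun u hu => ?_)
      exact (hlim u i ((G.mem_neighborFinset i u).1
        (Finset.mem_of_mem_erase hu)).symm).const_mul _
    exact tendsto_nhds_unique h1 h2
  -- Strictness survives the limit: γs = F(γs) ≤ F(v) < v.
  refine ⟨γs, hfix, fun v hv i j hij => ?_⟩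
  rw [hfix i j hij]
  exact (hv.update_mono (hle v hv) (fun _ _ _ => le_rfl) hij).trans_lt (hv.update_lt hij)

/-- Weighted contraction of the quadratic update towards its fixed point. -/
lemma IsConvexParameter.abs_update_sub_le (hv : IsConvexParameter G Γ v) {γ γs : V → V → ℝ}
    (hfix : ∀ i j, G.Adj i j → γs i j = 1 / updateDenom G Γ γs i j)
    (hlt : ∀ i j, G.Adj i j → γs i j < v i j)
    (hle : ∀ i j, G.Adj i j → γ i j ≤ v i j) {i j : V} (hij : G.Adj i j) {lam : ℝ}
    (hlam : ∀ u, G.Adj u i → |γ u i - γs u i| ≤ lam * (v u i - γs u i)) :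
    |1 / updateDenom G Γ γ i j - γs i j| ≤
      lam * (1 / updateDenom G Γ v i j - γs i j) := by
  have hle' : ∀ i j, G.Adj i j → γs i j ≤ v i j := fun i j h => (hlt i j h).le
  have p1 := hv.updateDenom_pos hle hij
  have p2 := hv.updateDenom_pos hle' hij
  have p3 := hv.updateDenom_pos (fun _ _ _ => le_rfl) hij
  have p4 := updateDenom_anti (Γ := Γ) hle i j
  have key : |updateDenom G Γ γs i j - updateDenom G Γ γ i j| ≤
      lam * (updateDenom G Γ γs i j - updateDenom G Γ v i j) := by
    have e : ∀ γ', updateDenom G Γ γs i j - updateDenom G Γ γ' i j =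
        ∑ u ∈ (G.neighborFinset i).erase j, Γ u i ^ 2 * (γ' u i - γs u i) := by
      intro γ'
      simp only [updateDenom, mul_sub, Finset.sum_sub_distrib]
      ring
    rw [e, e, Finset.mul_sum]
    refine (Finset.abs_sum_le_sum_abs _ _).trans (Finset.sum_le_sum fun u hu => ?_)
    rw [abs_mul, abs_of_nonneg (sq_nonneg (Γ u i))]
    have := mul_le_mul_of_nonneg_left (hlam u ((G.mem_neighborFinset i u).1
        (Finset.mem_of_mem_erase hu)).symm) (sq_nonneg (Γ u i))
    linarith
  rw [hfix i j hij]
  have e : ∀ x, 0 < x → 1 / x - 1 / updateDenom G Γ γs i j =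
      (updateDenom G Γ γs i j - x) / (x * updateDenom G Γ γs i j) := by
    intro x hx
    field_simp
  rw [e _ p1, e _ p3, abs_div, abs_of_pos (mul_pos p1 p2), ← mul_div_assoc]
  exact div_le_div₀ ((abs_nonneg _).trans key) key (mul_pos p3 p2)
    (mul_le_mul_of_nonneg_right p4 p2.le)

end FixedPoint

/-! ### Generalized diagonal dominance and weights for the linear update -/

section DiagonalDominance

variable {G : SimpleGraph V} [DecidableRel G.Adj] {Γ : Matrix V V ℝ} {v : V → V → ℝ}

omit [DecidableEq V] in
lemma sum_neighborFinset_comm (φ : V → V → ℝ) :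
    ∑ i, ∑ j ∈ G.neighborFinset i, φ i j = ∑ i, ∑ j ∈ G.neighborFinset i, φ j i :=
  Finset.sum_comm' fun i j => by simp [G.adj_comm]

-- Each cross term is split between its endpoints by the positive semidefinite edge form of v; what
-- remains at a vertex is x_i² times a positive vertex coefficient.
omit [DecidableEq V] in
lemma IsConvexParameter.sum_mul_pos (hv : IsConvexParameter G Γ v)
    (hsymm : ∀ i j, Γ i j = Γ j i) {x : V → ℝ} (hx : x ≠ 0) :
    0 < ∑ i, x i * (x i - ∑ j ∈ G.neighborFinset i, |Γ i j| * x j) := by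
  have h1 : ∑ i, ∑ j ∈ G.neighborFinset i, x i * (|Γ i j| * x j) ≤
      ∑ i, ∑ j ∈ G.neighborFinset i,
        (1 / 2 * (Γ j i ^ 2 * v j i * x i ^ 2) + 1 / 2 * (Γ i j ^ 2 * v i j * x j ^ 2)) := by
    refine Finset.sum_le_sum fun i _ => Finset.sum_le_sum fun j hj => ?_
    have hij := (G.mem_neighborFinset i j).1 hj
    have h2 := hv.one_le i j hij
    have p1 := hv.pos i j hij
    have p2 := hv.pos j i hij.symm
    rw [hsymm j i, ← sq_abs (Γ i j)]
    rw [← sq_abs (Γ i j)] at h2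
    set g := |Γ i j|
    have hg : 0 ≤ g := abs_nonneg _
    -- Times v_ji, the expression is the square of g v_ji x_i - x_j plus (g² v_ij v_ji - 1) x_j².
    have q : 0 ≤ v j i * (g ^ 2 * v j i * x i ^ 2 + g ^ 2 * v i j * x j ^ 2
        - 2 * (x i * (g * x j))) := by
      nlinarith [sq_nonneg (g * v j i * x i - x j),
        mul_nonneg (sub_nonneg.2 h2) (sq_nonneg (x j))]
    have := nonneg_of_mul_nonneg_right q p2
    linarith
  have h3 : ∑ i, ∑ j ∈ G.neighborFinset i,
        (1 / 2 * (Γ j i ^ 2 * v j i * x i ^ 2) + 1 / 2 * (Γ i j ^ 2 * v i j * x j ^ 2)) =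
      ∑ i, x i ^ 2 * ∑ j ∈ G.neighborFinset i, Γ j i ^ 2 * v j i := by
    simp only [Finset.sum_add_distrib]
    rw [sum_neighborFinset_comm fun i j => 1 / 2 * (Γ i j ^ 2 * v i j * x j ^ 2),
      ← Finset.sum_add_distrib]
    refine Finset.sum_congr rfl fun i _ => ?_
    rw [← Finset.sum_add_distrib, Finset.mul_sum]
    exact Finset.sum_congr rfl fun j _ => by ring
  obtain ⟨k, hk⟩ := Function.ne_iff.1 hx
  have h4 : 0 < ∑ i, x i ^ 2 * (1 - ∑ j ∈ G.neighborFinset i, Γ j i ^ 2 * v j i) :=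
    Finset.sum_pos' (fun i _ => mul_nonneg (sq_nonneg _) (sub_nonneg.2 (hv.sum_lt i).le))
      ⟨k, Finset.mem_univ k, mul_pos (sq_pos_of_ne_zero hk) (sub_pos.2 (hv.sum_lt k))⟩
  simp only [mul_sub, Finset.sum_sub_distrib, mul_one, Finset.mul_sum, ← sq] at h1 h3 h4 ⊢
  linarith

omit [DecidableEq V] in
/-- Existence of a convex parameter makes `Γ` generalized diagonally dominant. -/
lemma IsConvexParameter.exists_dominant (hv : IsConvexParameter G Γ v)
    (hsymm : ∀ i j, Γ i j = Γ j i) :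
    ∃ d : V → ℝ, (∀ i, 0 < d i) ∧ ∀ i, ∑ j ∈ G.neighborFinset i, |Γ i j| * d j < d i := by
  let L : (V → ℝ) →ₗ[ℝ] V → ℝ :=
    { toFun := fun x i => x i - ∑ j ∈ G.neighborFinset i, |Γ i j| * x j
      map_add' := fun x y => by
        ext i
        simp only [Pi.add_apply, mul_add, Finset.sum_add_distrib]
        ring
      map_smul' := fun c x => by
        ext i
        simp only [Pi.smul_apply, smul_eq_mul, RingHom.id_apply, mul_sub, Finset.mul_sum]
        congr 1
        exact Finset.sum_congr rfl fun j _ => by ring }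
  have hL : ∀ x i, L x i = x i - ∑ j ∈ G.neighborFinset i, |Γ i j| * x j := fun _ _ => rfl
  have hinj : Function.Injective L := by
    rw [injective_iff_map_eq_zero]
    intro x hx
    by_contra hne
    have := hv.sum_mul_pos hsymm hne
    simp only [← hL, hx, Pi.zero_apply, mul_zero, Finset.sum_const_zero, lt_irrefl] at this
  obtain ⟨d, hd⟩ := LinearMap.injective_iff_surjective.1 hinj 1
  have hd' : ∀ i, d i - ∑ j ∈ G.neighborFinset i, |Γ i j| * d j = 1 := fun i => by
    rw [← hL, hd, Pi.one_apply]
  -- Where the negative part n of d is nonzero, n_i - ∑ |Γ_ij| n_j ≤ -(L d)_i = -1, so the positive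
  -- definite form would be nonpositive at n.
  have hneg : (fun i => max (-d i) 0) = (0 : V → ℝ) := by
    by_contra hne
    have := hv.sum_mul_pos hsymm hne
    refine absurd this (not_lt.2 (Finset.sum_nonpos fun i _ => ?_))
    have h1 : ∑ j ∈ G.neighborFinset i, |Γ i j| * (-d j) ≤
        ∑ j ∈ G.neighborFinset i, |Γ i j| * max (-d j) 0 :=
      Finset.sum_le_sum fun j _ =>
        mul_le_mul_of_nonneg_left (le_max_left _ _) (abs_nonneg _)
    simp only [mul_neg, Finset.sum_neg_distrib] at h1
    have h2 := hd' i
    rcases le_total (-d i) 0 with h | h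
    · simp [max_eq_right h]
    · rw [max_eq_left h]
      exact mul_nonpos_of_nonneg_of_nonpos h (by linarith)
  have hnn : ∀ i, 0 ≤ d i := fun i => by
    have := congrFun hneg i
    have h2 := le_max_left (-d i) 0
    simp only [Pi.zero_apply] at this
    linarith
  refine ⟨d, fun i => ?_, fun i => by linarith [hd' i]⟩
  have := Finset.sum_nonneg fun j (_ : j ∈ G.neighborFinset i) =>
    mul_nonneg (abs_nonneg (Γ i j)) (hnn j)
  linarith [hd' i]

-- Here Γ_ij² v_ij v_ji = 1 exactly, and the vertex condition becomes the dominance inequality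
-- divided by d_j.
omit [DecidableEq V] in
lemma isConvexParameter_of_dominant (hsymm : ∀ i j, Γ i j = Γ j i)
    (hedge : ∀ i j, G.Adj i j → Γ i j ≠ 0) {d : V → ℝ} (hd : ∀ i, 0 < d i)
    (hdom : ∀ i, ∑ j ∈ G.neighborFinset i, |Γ i j| * d j < d i) :
    IsConvexParameter G Γ fun i j => d i / (|Γ i j| * d j) where
  pos i j hij := div_pos (hd i) (mul_pos (abs_pos.2 (hedge i j hij)) (hd j))
  one_le i j hij := by
    have h1 := abs_pos.2 (hedge i j hij)
    have h2 := hd i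
    have h3 := hd j
    rw [hsymm j i, ← sq_abs (Γ i j)]
    apply le_of_eq
    field_simp
  sum_lt j := by
    have : ∑ i ∈ G.neighborFinset j, Γ i j ^ 2 * (d i / (|Γ i j| * d j)) =
        (∑ i ∈ G.neighborFinset j, |Γ j i| * d i) / d j := by
      rw [Finset.sum_div]
      refine Finset.sum_congr rfl fun i hi => ?_
      have h1 := abs_pos.2 (hedge i j ((G.mem_neighborFinset j i).1 hi).symm)
      have h3 := hd j
      rw [hsymm j i, ← sq_abs (Γ i j)]
      field_simp
    rw [this, div_lt_one (hd j)]
    exact hdom j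

/-- Positive weights in which the limiting linear update is a strict contraction. -/
lemma exists_linear_weights (hsymm : ∀ i j, Γ i j = Γ j i)
    (hedge : ∀ i j, G.Adj i j → Γ i j ≠ 0) (hv : IsConvexParameter G Γ v) {γs : V → V → ℝ}
    (hfix : ∀ i j, G.Adj i j → γs i j = 1 / updateDenom G Γ γs i j)
    (hlt : ∀ v, IsConvexParameter G Γ v → ∀ i j, G.Adj i j → γs i j < v i j) :
    ∃ s : V → V → ℝ, (∀ i j, G.Adj i j → 0 < s i j) ∧ ∀ i j, G.Adj i j →
      |Γ i j| * γs i j * ∑ u ∈ (G.neighborFinset i).erase j, s u i < s i j := by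
  obtain ⟨d, hd, hdom⟩ := hv.exists_dominant hsymm
  have hlt' := hlt _ (isConvexParameter_of_dominant hsymm hedge hd hdom)
  -- Up to sign, this s is the fixed point of the linear update for the matrix with off-diagonal
  -- entries -|Γ_ij| on edges and right-hand side d_i - ∑ |Γ_ij| d_j. That right-hand side is
  -- positive, which makes the inequality strict; s > 0 says that γs lies below the convex parameter
  -- built from d.
  refine ⟨fun i j => |Γ i j| * d i - Γ i j ^ 2 * γs i j * d j, fun i j hij => ?_,
    fun i j hij => ?_⟩
  · have h1 := abs_pos.2 (hedge i j hij)
    have h2 := hlt' i j hij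
    rw [lt_div_iff₀ (mul_pos h1 (hd j))] at h2
    beta_reduce
    rw [← sq_abs (Γ i j)]
    nlinarith
  · have p := hv.updateDenom_pos (fun i j h => (hlt v hv i j h).le) hij
    have hγ : 0 < γs i j := by rw [hfix i j hij]; exact one_div_pos.2 p
    have e1 : γs i j * updateDenom G Γ γs i j = 1 := by
      rw [hfix i j hij, one_div_mul_cancel p.ne']
    have e2 := Finset.add_sum_erase (G.neighborFinset i) (fun u => |Γ i u| * d u)
      ((G.mem_neighborFinset i j).2 hij)
    have e3 : ∑ u ∈ (G.neighborFinset i).erase j, (|Γ u i| * d u - Γ u i ^ 2 * γs u i * d i) =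
        ∑ u ∈ (G.neighborFinset i).erase j, |Γ i u| * d u
          + (updateDenom G Γ γs i j - 1) * d i := by
      rw [Finset.sum_sub_distrib, ← Finset.sum_mul, updateDenom]
      simp only [fun u => hsymm u i]
      ring
    rw [e3]
    have h1 := abs_pos.2 (hedge i j hij)
    have h2 := hdom i
    have h3 : ∑ u ∈ (G.neighborFinset i).erase j, |Γ i u| * d u
        + (updateDenom G Γ γs i j - 1) * d i <
        updateDenom G Γ γs i j * d i - |Γ i j| * d j := by linarith
    refine (mul_lt_mul_of_pos_left h3 (mul_pos h1 hγ)).trans_eq ?_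
    beta_reduce
    rw [← sq_abs (Γ i j)]
    linear_combination (|Γ i j| * d i) * e1

end DiagonalDominance

/-! ### Totally asynchronous convergence -/

section Asynchronous

variable {G : SimpleGraph V} [DecidableRel G.Adj] {T : V → Set ℕ} {τ : V → V → ℕ → ℕ}

omit [DecidableEq V] in
lemma TotallyAsynchronous.eventually_ge (hT : TotallyAsynchronous G T τ) (N : ℕ) :
    ∀ᶠ t in atTop, ∀ i, t ∈ T i → ∀ u, G.Adj u i → N ≤ τ u i t := by
  refine eventually_all.2 fun i => ?_
  have h : ∀ u, ∀ᶠ t in atTop, t ∈ T i → G.Adj u i → N ≤ τ u i t := fun u => by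
    by_cases hu : G.Adj u i
    · filter_upwards [eventually_inf_principal.1 ((hT.tendsto u i hu).eventually_ge_atTop N)]
        with t ht hti _ using ht hti
    · exact Eventually.of_forall fun t _ h => absurd h hu
  filter_upwards [eventually_all.2 h] with t ht hti u hu using ht u hti hu

omit [DecidableEq V] in
/-- Convergence to zero of quantities that contract, up to a vanishing perturbation, in a
weighted maximum norm under totally asynchronous updates. -/
lemma TotallyAsynchronous.tendsto_zero (hT : TotallyAsynchronous G T τ) {w : V → V → ℝ}
    (hw : ∀ i j, G.Adj i j → 0 < w i j) {E : ℕ → V → V → ℝ} (hE : ∀ t i j, 0 ≤ E t i j)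
    {ρ : ℝ} (hρ0 : 0 ≤ ρ) (hρ1 : ρ < 1)
    (idle : ∀ t i j, G.Adj i j → t ∉ T i → E (t + 1) i j = E t i j)
    (update : ∀ η > 0, ∃ t₀, ∀ lam ≥ 0, ∀ t ≥ t₀, ∀ i j, G.Adj i j → t ∈ T i →
      (∀ u, G.Adj u i → E (τ u i t) u i ≤ lam * w u i) →
      E (t + 1) i j ≤ (ρ * lam + η) * w i j) {i j : V} (hij : G.Adj i j) :
    Tendsto (fun t => E t i j) atTop (𝓝 0) := by
  obtain ⟨C, hC1, hC⟩ : ∃ C ≥ (1 : ℝ), ∀ t i j, G.Adj i j → E t i j ≤ C * w i j := by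
    -- With this η, C ≥ 1 gives ρ C + η ≤ C, so the box of size C is never left after time t₀.
    obtain ⟨t₀, ht₀⟩ := update (1 - ρ) (by linarith)
    have h1 : ∀ᶠ C : ℝ in atTop, ∀ t ∈ Set.Iic t₀, ∀ i j, G.Adj i j → E t i j ≤ C * w i j := by
      refine (Filter.eventually_all_finite (Set.finite_Iic t₀)).2 fun t _ =>
        eventually_all.2 fun i => eventually_all.2 fun j => ?_
      by_cases hij : G.Adj i j
      · filter_upwards [(tendsto_id.atTop_mul_const (hw i j hij)).eventually_ge_atTop
          (E t i j)] with C hC _ using hC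
      · exact Eventually.of_forall fun _ h => absurd h hij
    obtain ⟨C, hC, hC1⟩ := (h1.and (eventually_ge_atTop 1)).exists
    refine ⟨C, hC1, fun t => ?_⟩
    induction t using Nat.strong_induction_on with
    | _ t ih =>
      intro i j hij
      rcases le_or_gt t t₀ with h | h
      · exact hC t h i j hij
      · obtain ⟨s, rfl⟩ : ∃ s, t = s + 1 := ⟨t - 1, by omega⟩
        by_cases hs : s ∈ T i
        · refine (ht₀ C (by linarith) s (by omega) i j hij hs fun u hu =>
            ih _ (by have := hT.delay_le u i s hu; omega) u i hu).trans ?_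
          exact mul_le_mul_of_nonneg_right (by nlinarith) (hw i j hij).le
        · rw [idle s i j hij hs]
          exact ih s (by omega) i j hij
  -- A rate strictly between ρ and 1 leaves room for the perturbation.
  set r := (1 + ρ) / 2 with hr
  have hr0 : 0 < r := by linarith
  have hr1 : r < 1 := by linarith
  have key : ∀ n : ℕ, ∃ t₁, ∀ t ≥ t₁, ∀ i j, G.Adj i j → E t i j ≤ C * r ^ n * w i j := by
    intro n
    induction n with
    | zero => exact ⟨0, fun t _ i j hij => by simpa using hC t i j hij⟩
    | succ n ih =>
      obtain ⟨t₁, ht₁⟩ := ih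
      have hpos : 0 < C * r ^ n := by positivity
      -- This η is chosen so that ρ (C rⁿ) + η = C rⁿ⁺¹.
      obtain ⟨t₀, ht₀⟩ := update ((r - ρ) * (C * r ^ n)) (mul_pos (by linarith) hpos)
      obtain ⟨S, hS⟩ := eventually_atTop.1 (hT.eventually_ge t₁)
      have hstep : ∀ t ≥ max S t₀, ∀ i j, G.Adj i j → t ∈ T i →
          E (t + 1) i j ≤ C * r ^ (n + 1) * w i j := by
        intro t ht i j hij hti
        refine (ht₀ (C * r ^ n) hpos.le t (le_of_max_le_right ht) i j hij hti fun u hu =>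
          ht₁ _ (hS t (le_of_max_le_left ht) i hti u hu) u i hu).trans_eq ?_
        ring
      -- Past S and t₀ every update lands in the smaller box, so the edges out of i stay in it after
      -- the first such update of i.
      choose s hsT hs using fun i => (hT.infinite i).exists_gt (max S t₀)
      refine ⟨Finset.univ.sup s + 1, fun t ht i j hij => ?_⟩
      have hst : s i + 1 ≤ t := by
        have := Finset.le_sup (f := s) (Finset.mem_univ i)
        omega
      clear ht
      induction t, hst using Nat.le_induction with
      | base => exact hstep _ (hs i).le i j hij (hsT i)
      | succ t ht ih =>
        by_cases hti : t ∈ T i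
        · exact hstep t (by have := hs i; omega) i j hij hti
        · rw [idle t i j hij hti]
          exact ih
  have hlim : Tendsto (fun n : ℕ => C * r ^ n * w i j) atTop (𝓝 0) := by
    simpa using ((tendsto_pow_atTop_nhds_zero_of_lt_one hr0.le hr1).const_mul C).mul_const
      (w i j)
  rw [Metric.tendsto_atTop]
  intro ε hε
  obtain ⟨n, hn⟩ := (hlim.eventually_lt_const hε).exists
  obtain ⟨t₁, ht₁⟩ := key n
  refine ⟨t₁, fun t ht => ?_⟩
  rw [Real.dist_eq, sub_zero, abs_of_nonneg (hE t i j)]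
  exact (ht₁ t ht i j hij).trans_lt hn

variable {Γ : Matrix V V ℝ} {h : V → ℝ} {γ z : ℕ → V → V → ℝ} {v : V → V → ℝ}

-- Finitely many strict inequalities survive a factor ρ slightly below 1.
omit [DecidableEq V] in
lemma exists_contraction_factor {a b : V → V → ℝ}
    (hab : ∀ i j, G.Adj i j → a i j < b i j) :
    ∃ ρ : ℝ, 0 ≤ ρ ∧ ρ < 1 ∧ ∀ i j, G.Adj i j → a i j < ρ * b i j := by
  have h1 : ∀ᶠ ρ : ℝ in 𝓝[<] 1, ∀ i j, G.Adj i j → a i j < ρ * b i j := by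
    refine eventually_all.2 fun i => eventually_all.2 fun j => ?_
    by_cases hij : G.Adj i j
    · have hc : Tendsto (fun ρ : ℝ => ρ * b i j) (𝓝[<] 1) (𝓝 (1 * b i j)) :=
        (tendsto_id.mul_const _).mono_left nhdsWithin_le_nhds
      filter_upwards [hc.eventually_const_lt (by rw [one_mul]; exact hab i j hij)] with ρ hρ _ using hρ
    · exact Eventually.of_forall fun _ h => absurd h hij
  have h2 : ∀ᶠ ρ : ℝ in 𝓝[<] 1, 0 < ρ :=
    nhdsWithin_le_nhds (lt_mem_nhds one_pos)
  obtain ⟨ρ, ⟨h1, h2⟩, h3⟩ := ((h1.and h2).and self_mem_nhdsWithin).exists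
  exact ⟨ρ, h2.le, h3, h1⟩

/-- Since F(v) < v and F is monotone, the region below v is invariant whatever the delays; no lower
bound on γ is needed. -/
lemma IsAsyncRun.quadratic_le (hrun : IsAsyncRun G Γ h T τ γ z)
    (hT : TotallyAsynchronous G T τ) (hv : IsConvexParameter G Γ v)
    (h0 : ∀ i j, G.Adj i j → γ 0 i j ≤ v i j) :
    ∀ t i j, G.Adj i j → γ t i j ≤ v i j := by
  intro t
  induction t using Nat.strong_induction_on with
  | _ t ih =>
    intro i j hij
    rcases t with _ | t
    · exact h0 i j hij
    by_cases ht : t ∈ T i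
    · rw [hrun.quadratic_update t i j hij ht]
      change 1 / (1 - ∑ u ∈ (G.neighborFinset i).erase j, Γ u i ^ 2 * γ (τ u i t) u i) ≤ _
      have hle : ∀ u ∈ (G.neighborFinset i).erase j, γ (τ u i t) u i ≤ v u i := fun u hu => by
        have hu' := ((G.mem_neighborFinset i u).1 (Finset.mem_of_mem_erase hu)).symm
        exact ih _ (Nat.lt_succ_of_le (hT.delay_le u i t hu')) u i hu'
      refine le_trans ?_ (hv.update_lt hij).le
      refine one_div_le_one_div_of_le (hv.updateDenom_pos (fun _ _ _ => le_rfl) hij) ?_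
      exact sub_le_sub_left (Finset.sum_le_sum fun u hu =>
        mul_le_mul_of_nonneg_left (hle u hu) (sq_nonneg _)) _
    · rw [(hrun.idle t i j hij ht).1]
      exact ih t (Nat.lt_succ_self t) i j hij

lemma asyncDenom_eq_updateDenom (t : ℕ) (i j : V) :
    asyncDenom G Γ τ γ t i j = updateDenom G Γ (fun u k => γ (τ u k t) u k) i j := rfl

lemma IsAsyncRun.tendsto_quadratic (hrun : IsAsyncRun G Γ h T τ γ z)
    (hT : TotallyAsynchronous G T τ) (hv : IsConvexParameter G Γ v)
    (hle : ∀ t i j, G.Adj i j → γ t i j ≤ v i j) {γs : V → V → ℝ}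
    (hfix : ∀ i j, G.Adj i j → γs i j = 1 / updateDenom G Γ γs i j)
    (hlt : ∀ i j, G.Adj i j → γs i j < v i j) {i j : V} (hij : G.Adj i j) :
    Tendsto (fun t => γ t i j) atTop (𝓝 (γs i j)) := by
  have hw : ∀ i j, G.Adj i j → 0 < v i j - γs i j := fun i j h => sub_pos.2 (hlt i j h)
  obtain ⟨ρ, hρ0, hρ1, hρ⟩ := exists_contraction_factor (G := G)
    (a := fun i j => 1 / updateDenom G Γ v i j - γs i j)
    (b := fun i j => v i j - γs i j) fun i j hij => sub_lt_sub_right (hv.update_lt hij) _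
  rw [tendsto_iff_norm_sub_tendsto_zero]
  refine hT.tendsto_zero (E := fun t i j => |γ t i j - γs i j|) hw (fun _ _ _ => abs_nonneg _)
    hρ0 hρ1 (fun t i j hij ht => ?_) (fun η hη => ⟨0, fun lam hlam t _ i j hij ht hu => ?_⟩) hij
  · rw [(hrun.idle t i j hij ht).1]
  · rw [hrun.quadratic_update t i j hij ht, asyncDenom_eq_updateDenom]
    refine (hv.abs_update_sub_le hfix hlt (fun u k huk => hle _ u k huk) hij hu).trans ?_
    have h1 := mul_le_mul_of_nonneg_left (hρ i j hij).le hlam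
    have h2 := mul_pos hη (hw i j hij)
    linarith

lemma IsAsyncRun.tendsto_linear (hrun : IsAsyncRun G Γ h T τ γ z)
    (hT : TotallyAsynchronous G T τ) (hv : IsConvexParameter G Γ v)
    (hle : ∀ t i j, G.Adj i j → γ t i j ≤ v i j) {γs zs s : V → V → ℝ}
    (hγ : ∀ i j, G.Adj i j → Tendsto (fun t => γ t i j) atTop (𝓝 (γs i j)))
    (hs : ∀ i j, G.Adj i j → 0 < s i j)
    (hs' : ∀ i j, G.Adj i j →
      |Γ i j| * γs i j * ∑ u ∈ (G.neighborFinset i).erase j, s u i < s i j)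
    (hzs : ∀ i j, G.Adj i j →
      zs i j = Γ i j * γs i j * (h i - ∑ u ∈ (G.neighborFinset i).erase j, zs u i))
    {i j : V} (hij : G.Adj i j) :
    Tendsto (fun t => z t i j) atTop (𝓝 (zs i j)) := by
  obtain ⟨ρ, hρ0, hρ1, hρ⟩ := exists_contraction_factor (G := G) hs'
  rw [tendsto_iff_norm_sub_tendsto_zero]
  refine hT.tendsto_zero (E := fun t i j => |z t i j - zs i j|) hs (fun _ _ _ => abs_nonneg _)
    hρ0 hρ1 (fun t i j hij ht => ?_) (fun η hη => ?_) hij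
  · rw [(hrun.idle t i j hij ht).2]
  set H : V → V → ℝ := fun i j => h i - ∑ u ∈ (G.neighborFinset i).erase j, zs u i with hH
  have hev : ∀ᶠ t in atTop, ∀ i j, G.Adj i j →
      |Γ i j| * γ (t + 1) i j * ∑ u ∈ (G.neighborFinset i).erase j, s u i < ρ * s i j ∧
      |Γ i j * (γ (t + 1) i j - γs i j) * H i j| < η * s i j := by
    refine eventually_all.2 fun i => eventually_all.2 fun j => ?_
    by_cases hij : G.Adj i j
    · have h1 := (hγ i j hij).comp (tendsto_add_atTop_nat 1)
      have h2 := (h1.const_mul |Γ i j|).mul_const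
        (∑ u ∈ (G.neighborFinset i).erase j, s u i)
      have h3 := (((h1.sub_const (γs i j)).const_mul (Γ i j)).mul_const (H i j)).abs
      rw [sub_self, mul_zero, zero_mul, abs_zero] at h3
      filter_upwards [h2.eventually_lt_const (hρ i j hij),
        h3.eventually_lt_const (mul_pos hη (hs i j hij))] with t ht1 ht2 _ using ⟨ht1, ht2⟩
    · exact Eventually.of_forall fun _ h => absurd h hij
  obtain ⟨t₀, ht₀⟩ := eventually_atTop.1 hev
  refine ⟨t₀, fun lam hlam t htt i j hij ht hu => ?_⟩
  obtain ⟨b1, b2⟩ := ht₀ t htt i j hij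
  have hz : z (t + 1) i j = Γ i j * γ (t + 1) i j *
      (h i - ∑ u ∈ (G.neighborFinset i).erase j, z (τ u i t) u i) := by
    rw [hrun.linear_update t i j hij ht, hrun.quadratic_update t i j hij ht]
    ring
  have hpos : 0 ≤ γ (t + 1) i j := by
    rw [hrun.quadratic_update t i j hij ht, asyncDenom_eq_updateDenom]
    exact (one_div_pos.2 (hv.updateDenom_pos (fun u k huk => hle _ u k huk) hij)).le
  -- The first term contracts, with coefficients close to their limits; the second is the
  -- perturbation caused by γ not having converged yet.
  have e : z (t + 1) i j - zs i j =
      -(Γ i j * γ (t + 1) i j *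
        ∑ u ∈ (G.neighborFinset i).erase j, (z (τ u i t) u i - zs u i))
      + Γ i j * (γ (t + 1) i j - γs i j) * H i j := by
    rw [hz, hzs i j hij, Finset.sum_sub_distrib, hH]
    ring
  have hsum : |∑ u ∈ (G.neighborFinset i).erase j, (z (τ u i t) u i - zs u i)| ≤
      lam * ∑ u ∈ (G.neighborFinset i).erase j, s u i := by
    rw [Finset.mul_sum]
    exact (Finset.abs_sum_le_sum_abs _ _).trans (Finset.sum_le_sum fun u hu' =>
      hu u ((G.mem_neighborFinset i u).1 (Finset.mem_of_mem_erase hu')).symm)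
  rw [e]
  refine (abs_add_le _ _).trans ?_
  rw [abs_neg, abs_mul, abs_mul (Γ i j), abs_of_nonneg hpos]
  have h1 := mul_le_mul_of_nonneg_left hsum (mul_nonneg (abs_nonneg (Γ i j)) hpos)
  have h2 := mul_le_mul_of_nonneg_left b1.le hlam
  linarith

/-- Convergence of the totally asynchronous algorithm to the solution of `Γ x = h`. -/
lemma IsAsyncRun.converges (hrun : IsAsyncRun G Γ h T τ γ z)
    (hT : TotallyAsynchronous G T τ) (hsymm : ∀ i j, Γ i j = Γ j i)
    (hedge : ∀ i j, G.Adj i j → Γ i j ≠ 0) (hv : IsConvexParameter G Γ v)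
    (hle : ∀ t i j, G.Adj i j → γ t i j ≤ v i j) {xs : V → ℝ}
    (hxs : ∀ i, xs i + ∑ j ∈ G.neighborFinset i, Γ i j * xs j = h i) {x : ℕ → V → ℝ}
    (hx : ∀ t j, x t j = 1 / (1 - ∑ i ∈ G.neighborFinset j, Γ i j ^ 2 * γ t i j) *
        (h j - ∑ i ∈ G.neighborFinset j, z t i j)) :
    ParametersConverge G γ z x ∧ Tendsto x atTop (𝓝 xs) := by
  obtain ⟨γs, hfix, hlt⟩ := exists_fixedPoint ⟨v, hv⟩
  obtain ⟨s, hs, hs'⟩ := exists_linear_weights hsymm hedge hv hfix hlt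
  have hγ : ∀ i j, G.Adj i j → Tendsto (fun t => γ t i j) atTop (𝓝 (γs i j)) :=
    fun i j hij => hrun.tendsto_quadratic hT hv hle hfix (hlt v hv) hij
  -- At the fixed point the message is an explicit function of the solution xs; this guess is
  -- verified in `hzs`, so the limit of the estimates needs no separate identification.
  let zs : V → V → ℝ := fun i j => Γ i j * xs i + Γ i j ^ 2 * γs i j * xs j
  have hsum : ∀ A : Finset V, ∀ i, ∑ u ∈ A, zs u i =
      ∑ u ∈ A, Γ i u * xs u + (∑ u ∈ A, Γ u i ^ 2 * γs u i) * xs i := by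
    intro A i
    simp only [zs]
    rw [Finset.sum_add_distrib, Finset.sum_mul]
    simp only [fun u => hsymm u i]
  have hzs : ∀ i j, G.Adj i j →
      zs i j = Γ i j * γs i j * (h i - ∑ u ∈ (G.neighborFinset i).erase j, zs u i) := by
    intro i j hij
    have p := hv.updateDenom_pos (fun i j h => (hlt v hv i j h).le) hij
    have e1 : γs i j * updateDenom G Γ γs i j = 1 := by
      rw [hfix i j hij, one_div_mul_cancel p.ne']
    have e2 := Finset.add_sum_erase (G.neighborFinset i) (fun u => Γ i u * xs u)
      ((G.mem_neighborFinset i j).2 hij)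
    have e3 : ∑ u ∈ (G.neighborFinset i).erase j, Γ u i ^ 2 * γs u i =
        1 - updateDenom G Γ γs i j := by rw [updateDenom]; ring
    rw [hsum, e3, ← hxs i, ← e2]
    simp only [zs]
    linear_combination (-(Γ i j * xs i)) * e1
  have hz : ∀ i j, G.Adj i j → Tendsto (fun t => z t i j) atTop (𝓝 (zs i j)) :=
    fun i j hij => hrun.tendsto_linear hT hv hle hγ hs hs' hzs hij
  have hxlim : Tendsto x atTop (𝓝 xs) := by
    rw [tendsto_pi_nhds]
    intro j
    have hmem : ∀ i ∈ G.neighborFinset j, G.Adj i j := fun i hi =>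
      ((G.mem_neighborFinset j i).1 hi).symm
    have hpos : 0 < 1 - ∑ i ∈ G.neighborFinset j, Γ i j ^ 2 * γs i j := by
      refine sub_pos.2 (lt_of_le_of_lt (Finset.sum_le_sum fun i hi => ?_) (hv.sum_lt j))
      exact mul_le_mul_of_nonneg_left (hlt v hv i j (hmem i hi)).le (sq_nonneg _)
    have e : xs j = 1 / (1 - ∑ i ∈ G.neighborFinset j, Γ i j ^ 2 * γs i j) *
        (h j - ∑ i ∈ G.neighborFinset j, zs i j) := by
      rw [hsum, ← hxs j, one_div, eq_inv_mul_iff_mul_eq₀ hpos.ne']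
      ring
    rw [e]
    simp only [hx]
    refine (tendsto_const_nhds.div (tendsto_const_nhds.sub
      (tendsto_finsetSum _ fun i hi => (hγ i j (hmem i hi)).const_mul _)) hpos.ne').mul
      (tendsto_const_nhds.sub (tendsto_finsetSum _ fun i hi => hz i j (hmem i hi)))
  exact ⟨⟨⟨γs, hγ⟩, ⟨zs, hz⟩, ⟨xs, hxlim⟩⟩, hxlim⟩

end Asynchronous

/-! ### From decompositions to parameters -/

section Decomposition

variable {G : SimpleGraph V} [DecidableRel G.Adj] {Γ : Matrix V V ℝ} {h : V → ℝ}
  {D C : Components V} {γ z v y : V → V → ℝ}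

/-- A quadratic polynomial that vanishes identically has zero coefficients. -/
lemma coeff_eq_zero_of_quadratic_eq_zero {M : Matrix V V ℝ} (hM : ∀ i j, M i j = M j i)
    {l : V → ℝ} {K : ℝ} (hP : ∀ x : V → ℝ, l ⬝ᵥ x + x ⬝ᵥ M.mulVec x + K = 0) :
    (∀ i, l i = 0) ∧ ∀ i j, M i j = 0 := by
  have h0 := hP 0
  have h1 : ∀ i, l i + M i i + K = 0 := fun i => by
    simpa [Matrix.mulVec_single_one] using hP (Pi.single i 1)
  have h2 : ∀ i, -l i + M i i + K = 0 := fun i => by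
    simpa [Matrix.mulVec_single_one, Matrix.mulVec_neg] using hP (-Pi.single i 1)
  have h3 : ∀ i j, (l i + l j) + (M i i + M j i + (M i j + M j j)) + K = 0 := fun i j => by
    have := hP (Pi.single i 1 + Pi.single j 1)
    rw [Matrix.mulVec_add, dotProduct_add, dotProduct_add, add_dotProduct, add_dotProduct] at this
    simp at this
    linarith
  simp only [dotProduct_zero, zero_dotProduct, zero_add] at h0
  refine ⟨fun i => by linarith [h1 i, h2 i], fun i j => ?_⟩
  linarith [h1 i, h2 i, h1 j, h2 j, h3 i j, hM i j]

/-- Matching coefficients: a quadratic decomposition of the objective has parameters, and `Γ`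
is supported on the graph. -/
lemma IsQuadraticDecomposition.exists_hasParameters
    (hD : IsQuadraticDecomposition G (objective Γ h) D) (hsymm : ∀ i j, Γ i j = Γ j i)
    (hdiag : ∀ i, Γ i i = 1) (hedge : ∀ i j, G.Adj i j → Γ i j ≠ 0) :
    (∃ γ z, HasParameters G Γ h D γ z) ∧ ∀ i j, i ≠ j → ¬ G.Adj i j → Γ i j = 0 := by
  choose α β κ hα using hD.quadratic_vertex
  have hq : ∀ i j, ∃ a b c d e k : ℝ, G.Adj i j → ∀ x y, D.edge i j x y =
      a * x ^ 2 + b * (x * y) + c * y ^ 2 + d * x + e * y + k := fun i j => by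
    by_cases hij : G.Adj i j
    · obtain ⟨a, b, c, d, e, k, hk⟩ := hD.quadratic_edge i j hij
      exact ⟨a, b, c, d, e, k, fun _ => hk⟩
    · exact ⟨0, 0, 0, 0, 0, 0, fun h => absurd h hij⟩
  choose a b c d e k hk using hq
  have hswap : ∀ i j, G.Adj i j → a i j = c j i ∧ b i j = b j i ∧ d i j = e j i := by
    intro i j hij
    have hs : ∀ x y : ℝ, a i j * x ^ 2 + b i j * (x * y) + c i j * y ^ 2 + d i j * x
        + e i j * y + k i j = a j i * y ^ 2 + b j i * (y * x) + c j i * x ^ 2 + d j i * y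
        + e j i * x + k j i := fun x y => by
      rw [← hk i j hij, ← hk j i hij.symm, hD.edge_symm i j hij]
    have h0 := hs 0 0
    have h1 := hs 1 0
    have h2 := hs (-1) 0
    have h3 := hs 0 1
    have h4 := hs 0 (-1)
    have h5 := hs 1 1
    norm_num at h0 h1 h2 h3 h4 h5
    exact ⟨by linarith, by linarith, by linarith⟩
  let A : V → ℝ := fun i => α i + ∑ j ∈ G.neighborFinset i, c j i
  let l : V → ℝ := fun i => β i + ∑ j ∈ G.neighborFinset i, e j i + h i
  let B : Matrix V V ℝ := Matrix.of fun i j => if G.Adj i j then b i j else 0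
  -- Here l, M and the constant are the coefficients of `D.total G x` minus the objective, with the
  -- edge terms collected at their endpoints.
  let M : Matrix V V ℝ := Matrix.diagonal A + (1 / 2 : ℝ) • (B - Γ)
  have htotal : ∀ x, D.total G x = (∑ i, (α i * x i ^ 2 + β i * x i + κ i))
      + (∑ i, (∑ j ∈ G.neighborFinset i, c j i) * x i ^ 2)
      + (∑ i, (∑ j ∈ G.neighborFinset i, e j i) * x i)
      + 1 / 2 * (x ⬝ᵥ B.mulVec x) + 1 / 2 * ∑ i, ∑ j ∈ G.neighborFinset i, k i j := by
    intro x
    have e1 : ∑ i, ∑ j ∈ G.neighborFinset i, D.edge i j (x i) (x j) =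
        ∑ i, ∑ j ∈ G.neighborFinset i, (c j i * x i ^ 2 + b i j * (x i * x j)
          + c i j * x j ^ 2 + e j i * x i + e i j * x j + k i j) :=
      Finset.sum_congr rfl fun i _ => Finset.sum_congr rfl fun j hj => by
        have hij := (G.mem_neighborFinset i j).1 hj
        rw [hk i j hij, (hswap i j hij).1, (hswap i j hij).2.2]
    have e2 : x ⬝ᵥ B.mulVec x = ∑ i, ∑ j ∈ G.neighborFinset i, b i j * (x i * x j) := by
      simp only [dotProduct, Matrix.mulVec, B, Matrix.of_apply, Finset.mul_sum]
      refine Finset.sum_congr rfl fun i _ => ?_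
      rw [SimpleGraph.neighborFinset_eq_filter, Finset.sum_filter]
      exact Finset.sum_congr rfl fun j _ => by split_ifs <;> ring
    rw [Components.total, e1, e2]
    simp only [hα, Finset.sum_add_distrib]
    rw [sum_neighborFinset_comm fun i j => c i j * x j ^ 2,
      sum_neighborFinset_comm fun i j => e i j * x j]
    simp only [Finset.sum_mul]
    ring
  have hzero : ∀ x : V → ℝ, l ⬝ᵥ x + x ⬝ᵥ M.mulVec x
      + (∑ i, κ i + 1 / 2 * ∑ i, ∑ j ∈ G.neighborFinset i, k i j) = 0 := by
    intro x
    have e1 := hD.sum_eq x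
    rw [htotal, objective] at e1
    have e2 : x ⬝ᵥ M.mulVec x = ∑ i, A i * x i ^ 2
        + 1 / 2 * (x ⬝ᵥ B.mulVec x) - 1 / 2 * (x ⬝ᵥ Γ.mulVec x) := by
      simp only [M, Matrix.add_mulVec, Matrix.smul_mulVec, Matrix.sub_mulVec, dotProduct_add,
        dotProduct_smul, dotProduct_sub, smul_eq_mul]
      have : x ⬝ᵥ (Matrix.diagonal A).mulVec x = ∑ i, A i * x i ^ 2 := by
        simp only [dotProduct, Matrix.mulVec_diagonal]
        exact Finset.sum_congr rfl fun i _ => by ring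
      rw [this]
      ring
    have e3 : l ⬝ᵥ x = ∑ i, β i * x i + ∑ i, (∑ j ∈ G.neighborFinset i, e j i) * x i
        + h ⬝ᵥ x := by
      simp only [dotProduct, l, add_mul, Finset.sum_add_distrib]
    rw [e2, e3]
    simp only [A, add_mul, Finset.sum_add_distrib] at e1 ⊢
    linarith
  have hMsymm : ∀ i j, M i j = M j i := by
    intro i j
    have : B i j = B j i := by
      simp only [B, Matrix.of_apply, G.adj_comm j i]
      split_ifs with hij
      · exact (hswap i j hij).2.1
      · rfl
    rcases eq_or_ne i j with rfl | hne
    · rfl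
    · simp [M, Matrix.diagonal_apply_ne _ hne, Matrix.diagonal_apply_ne _ hne.symm, this,
        hsymm i j]
  obtain ⟨hl, hM⟩ := coeff_eq_zero_of_quadratic_eq_zero hMsymm hzero
  have hoff : ∀ i j, i ≠ j → B i j = Γ i j := by
    intro i j hne
    have := hM i j
    simp only [M, Matrix.add_apply, Matrix.diagonal_apply_ne _ hne, Matrix.smul_apply,
      Matrix.sub_apply, smul_eq_mul] at this
    linarith
  have hon : ∀ i, A i = 1 / 2 := by
    intro i
    have := hM i i
    have hB : B i i = 0 := by simp [B]
    simp only [M, Matrix.add_apply, Matrix.diagonal_apply_eq, Matrix.smul_apply,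
      Matrix.sub_apply, smul_eq_mul, hB, hdiag] at this
    linarith
  have hbΓ : ∀ i j, G.Adj i j → b i j = Γ i j := fun i j hij => by
    rw [← hoff i j hij.ne]
    simp [B, hij]
  have hcan : ∀ i j, G.Adj i j → Γ i j ^ 2 * (2 * c i j / Γ i j ^ 2) = 2 * c i j :=
    fun i j hij => mul_div_cancel₀ _ (pow_ne_zero 2 (hedge i j hij))
  refine ⟨⟨fun i j => 2 * c i j / Γ i j ^ 2, fun i j => -e i j, fun j => ⟨κ j, fun x => ?_⟩,
    fun i j hij => ⟨k i j, fun x y => ?_⟩⟩, fun i j hne hij => ?_⟩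
  · have e1 : ∑ i ∈ G.neighborFinset j, Γ i j ^ 2 * (2 * c i j / Γ i j ^ 2) =
        2 * ∑ i ∈ G.neighborFinset j, c i j := by
      rw [Finset.mul_sum]
      exact Finset.sum_congr rfl fun i hi =>
        hcan i j ((G.mem_neighborFinset j i).1 hi).symm
    rw [e1, Finset.sum_neg_distrib, hα]
    have e2 := hon j
    have e3 := hl j
    simp only [A, l] at e2 e3
    linear_combination x ^ 2 * e2 + x * e3
  · have e1 := hcan i j hij
    have e2 := hcan j i hij.symm
    rw [hk i j hij, hbΓ i j hij, (hswap i j hij).1, (hswap i j hij).2.2]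
    rw [hsymm j i] at e2
    simp only [hsymm j i]
    linear_combination (-1 / 2 * x ^ 2) * e2 - (1 / 2 * y ^ 2) * e1
  · rw [← hoff i j hne]
    simp [B, hij]

omit [Fintype V] [DecidableEq V] in
lemma two_mul_le_of_convexOn {φ : ℝ × ℝ → ℝ} (hφ : ConvexOn ℝ Set.univ φ) (x y : ℝ) :
    2 * φ (0, 0) ≤ φ (x, y) + φ (-x, -y) := by
  have := hφ.2 (Set.mem_univ (x, y)) (Set.mem_univ (-x, -y))
    (by norm_num : (0 : ℝ) ≤ 1 / 2) (by norm_num : (0 : ℝ) ≤ 1 / 2) (by norm_num)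
  simp only [Prod.smul_mk, smul_eq_mul, Prod.mk_add_mk, mul_neg, add_neg_cancel] at this
  linarith

-- Evaluating convexity at opposite points removes linear terms, so only the edge forms and vertex
-- curvatures remain.
omit [DecidableEq V] in
lemma IsConvexDecomposition.isConvexParameter {f : (V → ℝ) → ℝ}
    (hC : IsConvexDecomposition G f C) (hp : HasParameters G Γ h C v y)
    (hedge : ∀ i j, G.Adj i j → Γ i j ≠ 0) :
    IsConvexParameter G Γ v := by
  have hform : ∀ i j, G.Adj i j → ∀ s t : ℝ,
      0 ≤ v j i * Γ i j ^ 2 * s ^ 2 + 2 * Γ i j * s * t + v i j * Γ i j ^ 2 * t ^ 2 := by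
    intro i j hij s t
    obtain ⟨c, hc⟩ := hp.2 i j hij
    have := two_mul_le_of_convexOn (hC.convex_edge i j hij) s t
    simp only [hc] at this
    linarith
  have hpos : ∀ i j, G.Adj i j → 0 < v i j := by
    intro i j hij
    have hg := hedge i j hij
    have hg2 : 0 < Γ i j ^ 2 := by positivity
    have h1 := hform i j hij 0 1
    -- If v_ij were 0, the form would equal -1 at this point.
    have h2 := hform i j hij 1 (-(v j i * Γ i j ^ 2 + 1) / (2 * Γ i j))
    have h3 : 0 ≤ v i j := nonneg_of_mul_nonneg_left (by linarith : 0 ≤ v i j * Γ i j ^ 2) hg2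
    refine h3.lt_of_ne fun h0 => ?_
    have h4 : 2 * Γ i j * 1 * (-(v j i * Γ i j ^ 2 + 1) / (2 * Γ i j)) =
        -(v j i * Γ i j ^ 2 + 1) := by field_simp
    rw [← h0, h4] at h2
    linarith
  refine ⟨hpos, fun i j hij => ?_, fun j => ?_⟩
  · have hg2 : 0 < Γ i j ^ 2 := pow_two_pos_of_ne_zero (hedge i j hij)
    -- For this first coordinate, -Γ_ij minimizes the form in the second, so its value carries the
    -- sign of the determinant.
    have h1 := hform i j hij (v i j * Γ i j ^ 2) (-Γ i j)
    have h2 : v j i * Γ i j ^ 2 * (v i j * Γ i j ^ 2) ^ 2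
        + 2 * Γ i j * (v i j * Γ i j ^ 2) * -Γ i j + v i j * Γ i j ^ 2 * (-Γ i j) ^ 2 =
        (v i j * Γ i j ^ 2 * Γ i j ^ 2) * (Γ i j ^ 2 * v i j * v j i - 1) := by ring
    rw [h2] at h1
    linarith [nonneg_of_mul_nonneg_right h1
      (mul_pos (mul_pos (hpos i j hij) hg2) hg2)]
  · obtain ⟨c, hc⟩ := hp.1 j
    have := (hC.strictConvex_vertex j).2 (Set.mem_univ 1) (Set.mem_univ (-1))
      (by norm_num) (by norm_num : (0 : ℝ) < 1 / 2) (by norm_num : (0 : ℝ) < 1 / 2)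
      (by norm_num)
    simp only [hc, smul_eq_mul] at this
    norm_num at this
    linarith

omit [DecidableEq V] in
lemma HasParameters.le_of_convexOn_sub (hD : HasParameters G Γ h D γ z)
    (hC : HasParameters G Γ h C v y) {i j : V} (hij : G.Adj i j) (hg : Γ i j ≠ 0)
    (hsub : ConvexOn ℝ Set.univ (fun p : ℝ × ℝ => C.edge i j p.1 p.2 - D.edge i j p.1 p.2)) :
    γ i j ≤ v i j := by
  obtain ⟨c, hc⟩ := hD.2 i j hij
  obtain ⟨c', hc'⟩ := hC.2 i j hij
  have := two_mul_le_of_convexOn hsub 0 1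
  simp only [hc, hc'] at this
  have hg2 : 0 < Γ i j ^ 2 := pow_two_pos_of_ne_zero hg
  have h1 : 0 ≤ (v i j - γ i j) * Γ i j ^ 2 := by linarith
  linarith [nonneg_of_mul_nonneg_left h1 hg2]

end Decomposition

/-! ### The synchronous update on the parameters -/

section Synchronous

variable {G : SimpleGraph V} [DecidableRel G.Adj] {Γ : Matrix V V ℝ} {h : V → ℝ}
  {D : Components V} {γ z : V → V → ℝ}

/-- Completing the square in the function minimized by the update at `(i, j)`. -/
lemma HasParameters.vertex_add_edge (hD : HasParameters G Γ h D γ z)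
    (hsymm : ∀ i j, Γ i j = Γ j i) {i j : V} (hij : G.Adj i j)
    (hd : updateDenom G Γ γ i j ≠ 0) :
    ∃ c : ℝ, ∃ m : ℝ → ℝ, ∀ x y, D.vertex i y + D.edge i j y x =
      1 / 2 * updateDenom G Γ γ i j * (y - m x) ^ 2
      + (1 / 2 * ((γ i j - 1 / updateDenom G Γ γ i j) * Γ i j ^ 2) * x ^ 2
        - (z i j - Γ i j * (h i - ∑ u ∈ (G.neighborFinset i).erase j, z u i)
          / updateDenom G Γ γ i j) * x + c) := by
  obtain ⟨c₁, hc₁⟩ := hD.1 i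
  obtain ⟨c₂, hc₂⟩ := hD.2 i j hij
  have e1 := updateDenom_eq_of_adj (Γ := Γ) (γ := γ) hij
  have e2 := Finset.add_sum_erase (G.neighborFinset i) (fun u => z u i)
    ((G.mem_neighborFinset i j).2 hij)
  set d := updateDenom G Γ γ i j
  set H := h i - ∑ u ∈ (G.neighborFinset i).erase j, z u i with hH
  refine ⟨c₁ + c₂ - H ^ 2 / (2 * d), fun x => (H - Γ i j * x) / d, fun x y => ?_⟩
  have e3 : 1 - ∑ u ∈ G.neighborFinset i, Γ u i ^ 2 * γ u i = d - Γ i j ^ 2 * γ j i := by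
    rw [hsymm i j]
    linarith
  have e4 : h i - ∑ u ∈ G.neighborFinset i, z u i = H - z j i := by
    rw [hH, ← e2]
    ring
  rw [hc₁, hc₂, e3, e4]
  field_simp
  ring

lemma HasParameters.wellPosed (hD : HasParameters G Γ h D γ z)
    (hsymm : ∀ i j, Γ i j = Γ j i) (hd : ∀ i j, G.Adj i j → 0 < updateDenom G Γ γ i j) :
    D.WellPosed G := by
  intro i j hij x
  obtain ⟨c, m, hm⟩ := hD.vertex_add_edge hsymm hij (hd i j hij).ne'
  refine ⟨m x, fun y => ?_⟩
  rw [hm, hm]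
  have := mul_nonneg (mul_nonneg (one_half_pos (α := ℝ)).le (hd i j hij).le)
    (sq_nonneg (y - m x))
  rw [sub_self]
  linarith

/-- The coefficients are old minus new parameters: the step moves exactly this difference from the
edges to the vertices. -/
lemma HasParameters.partialMin_eq (hD : HasParameters G Γ h D γ z)
    (hsymm : ∀ i j, Γ i j = Γ j i) {i j : V} (hij : G.Adj i j)
    (hd : 0 < updateDenom G Γ γ i j) :
    ∃ c : ℝ, ∀ x, D.partialMin i j x =
      1 / 2 * ((γ i j - 1 / updateDenom G Γ γ i j) * Γ i j ^ 2) * x ^ 2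
        - (z i j - Γ i j * (h i - ∑ u ∈ (G.neighborFinset i).erase j, z u i)
          / updateDenom G Γ γ i j) * x + c := by
  obtain ⟨c, m, hm⟩ := hD.vertex_add_edge hsymm hij hd.ne'
  refine ⟨c, fun x => IsLeast.csInf_eq ⟨⟨m x, ?_⟩, ?_⟩⟩
  · beta_reduce
    rw [hm, sub_self]
    ring
  · rintro _ ⟨y, rfl⟩
    beta_reduce
    rw [hm]
    exact le_add_of_nonneg_left
      (mul_nonneg (mul_nonneg (one_half_pos (α := ℝ)).le hd.le) (sq_nonneg _))

/-- One synchronous step in terms of the parameters. -/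
lemma HasParameters.step (hD : HasParameters G Γ h D γ z)
    (hsymm : ∀ i j, Γ i j = Γ j i) (hd : ∀ i j, G.Adj i j → 0 < updateDenom G Γ γ i j)
    (κv : V → ℝ) (κe : Sym2 V → ℝ) :
    HasParameters G Γ h (D.step G κv κe) (fun i j => 1 / updateDenom G Γ γ i j)
      fun i j => Γ i j * (h i - ∑ u ∈ (G.neighborFinset i).erase j, z u i)
        / updateDenom G Γ γ i j := by
  have hmin : ∀ i j, ∃ c : ℝ, G.Adj i j → ∀ x, D.partialMin i j x =
      1 / 2 * ((γ i j - 1 / updateDenom G Γ γ i j) * Γ i j ^ 2) * x ^ 2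
        - (z i j - Γ i j * (h i - ∑ u ∈ (G.neighborFinset i).erase j, z u i)
          / updateDenom G Γ γ i j) * x + c := fun i j => by
    by_cases hij : G.Adj i j
    · obtain ⟨c, hc⟩ := hD.partialMin_eq hsymm hij (hd i j hij)
      exact ⟨c, fun _ => hc⟩
    · exact ⟨0, fun h => absurd h hij⟩
  choose c hc using hmin
  refine ⟨fun j => ?_, fun i j hij => ?_⟩
  · obtain ⟨c₁, hc₁⟩ := hD.1 j
    refine ⟨κv j + c₁ + ∑ i ∈ G.neighborFinset j, c i j, fun x => ?_⟩
    have e : ∑ i ∈ G.neighborFinset j, D.partialMin i j x =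
        1 / 2 * (∑ i ∈ G.neighborFinset j, Γ i j ^ 2 * γ i j
          - ∑ i ∈ G.neighborFinset j, Γ i j ^ 2 * (1 / updateDenom G Γ γ i j)) * x ^ 2
        - (∑ i ∈ G.neighborFinset j, z i j - ∑ i ∈ G.neighborFinset j,
            Γ i j * (h i - ∑ u ∈ (G.neighborFinset i).erase j, z u i)
              / updateDenom G Γ γ i j) * x + ∑ i ∈ G.neighborFinset j, c i j := by
      rw [← Finset.sum_sub_distrib, ← Finset.sum_sub_distrib, Finset.mul_sum, Finset.sum_mul,
        Finset.sum_mul, ← Finset.sum_sub_distrib, ← Finset.sum_add_distrib]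
      refine Finset.sum_congr rfl fun i hi => ?_
      rw [hc i j ((G.mem_neighborFinset j i).1 hi).symm]
      ring
    change κv j + D.vertex j x + ∑ i ∈ G.neighborFinset j, D.partialMin i j x = _
    rw [e, hc₁]
    ring
  · obtain ⟨c₂, hc₂⟩ := hD.2 i j hij
    refine ⟨κe s(i, j) + c₂ - c i j - c j i, fun x y => ?_⟩
    change κe s(i, j) + D.edge i j x y - D.partialMin i j y - D.partialMin j i x = _
    rw [hc i j hij, hc j i hij.symm, hc₂]
    simp only [hsymm j i]
    ring

omit [DecidableEq V] in
lemma HasParameters.vertex_lt (hD : HasParameters G Γ h D γ z) {j : V}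
    (hd : ∑ i ∈ G.neighborFinset j, Γ i j ^ 2 * γ i j < 1) {y : ℝ}
    (hy : y ≠ 1 / (1 - ∑ i ∈ G.neighborFinset j, Γ i j ^ 2 * γ i j) *
      (h j - ∑ i ∈ G.neighborFinset j, z i j)) :
    D.vertex j (1 / (1 - ∑ i ∈ G.neighborFinset j, Γ i j ^ 2 * γ i j) *
      (h j - ∑ i ∈ G.neighborFinset j, z i j)) < D.vertex j y := by
  obtain ⟨c, hc⟩ := hD.1 j
  rw [hc, hc]
  have hs : 0 < 1 - ∑ i ∈ G.neighborFinset j, Γ i j ^ 2 * γ i j := sub_pos.2 hd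
  set s := 1 - ∑ i ∈ G.neighborFinset j, Γ i j ^ 2 * γ i j
  set l := h j - ∑ i ∈ G.neighborFinset j, z i j
  have e : l = s * (1 / s * l) := by field_simp
  set m := 1 / s * l
  have := mul_pos hs (pow_two_pos_of_ne_zero (sub_ne_zero.2 hy))
  rw [e]
  nlinarith

end Synchronous

/-! ### Minimizer and continuity of the objective -/

omit [DecidableEq V] in
lemma isLeast_objective {Γ : Matrix V V ℝ} (hΓ : Γ.PosDef) {h xs : V → ℝ}
    (hxs : Γ.mulVec xs = h) :
    IsLeast (Set.range (objective Γ h)) (objective Γ h xs) := by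
  refine ⟨⟨xs, rfl⟩, ?_⟩
  rintro _ ⟨x, rfl⟩
  have h1 := hΓ.posSemidef.dotProduct_mulVec_nonneg (x - xs)
  have h2 : xs ⬝ᵥ Γ.mulVec x = h ⬝ᵥ x := by
    have hT : Γ.transpose = Γ := by simpa using hΓ.isHermitian.eq
    rw [Matrix.dotProduct_mulVec, ← Matrix.mulVec_transpose, hT, hxs]
  simp only [star_trivial, Matrix.mulVec_sub, dotProduct_sub, sub_dotProduct, h2, hxs] at h1
  simp only [objective, hxs]
  rw [dotProduct_comm xs h, dotProduct_comm x h] at h1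
  rw [dotProduct_comm xs h]
  linarith

omit [DecidableEq V] in
lemma tendsto_objective {Γ : Matrix V V ℝ} {h xs : V → ℝ} {x : ℕ → V → ℝ}
    (hx : Tendsto x atTop (𝓝 xs)) :
    Tendsto (fun t => objective Γ h (x t)) atTop (𝓝 (objective Γ h xs)) := by
  have : Continuous (objective Γ h) := by
    unfold objective dotProduct Matrix.mulVec dotProduct
    fun_prop
  exact (this.tendsto xs).comp hx

end MinSum

/-! ### The convergence theorem -/

theorem theorem1 {V : Type*} [Fintype V] [DecidableEq V]
    (G : SimpleGraph V) [DecidableRel G.Adj]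
    (Γ : Matrix V V ℝ) (h : V → ℝ)
    (hΓ : Γ.PosDef) (hdiag : ∀ i, Γ i i = 1) (hedge : ∀ i j, G.Adj i j → Γ i j ≠ 0)
    (hf : MinSum.ConvexDecomposable G (MinSum.objective Γ h))
    (D : MinSum.Components V) (hD : MinSum.IsConvexDominated G (MinSum.objective Γ h) D) :
    -- the synchronous algorithm, for all choices of the additive offsets
    (∀ (κv : ℕ → V → ℝ) (κe : ℕ → Sym2 V → ℝ),
      (∀ t, (D.iterates G κv κe t).WellPosed G) ∧
      ∃ (γ z : ℕ → V → V → ℝ) (x : ℕ → V → ℝ),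
        (∀ t, MinSum.HasParameters G Γ h (D.iterates G κv κe t) (γ t) (z t)) ∧
        (∀ t j y, y ≠ x t j →
          (D.iterates G κv κe t).vertex j (x t j) < (D.iterates G κv κe t).vertex j y) ∧
        MinSum.ParametersConverge G γ z x ∧
        MinSum.AttainsMinInLimit (MinSum.objective Γ h) x) ∧
    -- the totally asynchronous algorithm
    (∀ (T : V → Set ℕ) (τ : V → V → ℕ → ℕ) (γ z : ℕ → V → V → ℝ) (x : ℕ → V → ℝ),
      MinSum.TotallyAsynchronous G T τ →
      MinSum.HasParameters G Γ h D (γ 0) (z 0) →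
      MinSum.IsAsyncRun G Γ h T τ γ z →
      (∀ t j, x t j = 1 / (1 - ∑ i ∈ G.neighborFinset j, Γ i j ^ 2 * γ t i j) *
        (h j - ∑ i ∈ G.neighborFinset j, z t i j)) →
      (∀ t i j, G.Adj i j → t ∈ T i → 0 < MinSum.asyncDenom G Γ τ γ t i j) ∧
      (∀ t j, ∑ i ∈ G.neighborFinset j, Γ i j ^ 2 * γ t i j < 1) ∧
      MinSum.ParametersConverge G γ z x ∧
      MinSum.AttainsMinInLimit (MinSum.objective Γ h) x) := by
  have hsymm : ∀ i j, Γ i j = Γ j i := fun i j => by simpa using (hΓ.isHermitian.apply i j).symm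
  obtain ⟨hDq, C, hC, hsub⟩ := hD
  obtain ⟨⟨γ₀, z₀, hp₀⟩, hoff⟩ := hDq.exists_hasParameters hsymm hdiag hedge
  obtain ⟨⟨v, y, hpC⟩, -⟩ :=
    hC.toIsQuadraticDecomposition.exists_hasParameters hsymm hdiag hedge
  have hv : MinSum.IsConvexParameter G Γ v := hC.isConvexParameter hpC hedge
  obtain ⟨xs, hxs⟩ : ∃ xs, Γ.mulVec xs = h :=
    Matrix.mulVec_surjective_iff_isUnit.2 hΓ.isUnit h
  -- Entries of Γ off the graph vanish because f decomposes over it, so Γ x = h involves neighbors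
  -- only.
  have hxs' : ∀ i, xs i + ∑ j ∈ G.neighborFinset i, Γ i j * xs j = h i := by
    intro i
    rw [← hxs, Matrix.mulVec, dotProduct,
      ← Finset.sum_subset (Finset.subset_univ (insert i (G.neighborFinset i))),
      Finset.sum_insert (by simp), hdiag, one_mul]
    intro j _ hj
    simp only [Finset.mem_insert, SimpleGraph.mem_neighborFinset, not_or] at hj
    rw [hoff i j (Ne.symm hj.1) hj.2, zero_mul]
  have hasync : ∀ (T : V → Set ℕ) (τ : V → V → ℕ → ℕ) (γ z : ℕ → V → V → ℝ) (x : ℕ → V → ℝ),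
      MinSum.TotallyAsynchronous G T τ →
      MinSum.HasParameters G Γ h D (γ 0) (z 0) →
      MinSum.IsAsyncRun G Γ h T τ γ z →
      (∀ t j, x t j = 1 / (1 - ∑ i ∈ G.neighborFinset j, Γ i j ^ 2 * γ t i j) *
        (h j - ∑ i ∈ G.neighborFinset j, z t i j)) →
      (∀ t i j, G.Adj i j → t ∈ T i → 0 < MinSum.asyncDenom G Γ τ γ t i j) ∧
      (∀ t j, ∑ i ∈ G.neighborFinset j, Γ i j ^ 2 * γ t i j < 1) ∧
      MinSum.ParametersConverge G γ z x ∧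
      MinSum.AttainsMinInLimit (MinSum.objective Γ h) x := by
    intro T τ γ z x hT hp hrun hx
    have hle := hrun.quadratic_le hT hv fun i j hij =>
      hp.le_of_convexOn_sub hpC hij (hedge i j hij) (hsub i j hij)
    have hconv := hrun.converges hT hsymm hedge hv hle hxs' hx
    refine ⟨fun t i j hij _ => ?_, fun t j => ?_, hconv.1, _,
      MinSum.isLeast_objective hΓ hxs, MinSum.tendsto_objective hconv.2⟩
    · rw [MinSum.asyncDenom_eq_updateDenom]
      exact hv.updateDenom_pos (fun u k huk => hle _ u k huk) hij
    · refine lt_of_le_of_lt (Finset.sum_le_sum fun i hi => ?_) (hv.sum_lt j)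
      exact mul_le_mul_of_nonneg_left
        (hle t i j ((G.mem_neighborFinset j i).1 hi).symm) (sq_nonneg _)
  refine ⟨fun κv κe => ?_, hasync⟩
  -- The synchronous recursion on parameters, independent of the offsets; it is an asynchronous run
  -- with `T i = univ` and `τ u i t = t`.
  let p : ℕ → (V → V → ℝ) × (V → V → ℝ) := fun t => Nat.rec (γ₀, z₀)
    (fun _ q => (fun i j => 1 / MinSum.updateDenom G Γ q.1 i j,
      fun i j => Γ i j * (h i - ∑ u ∈ (G.neighborFinset i).erase j, q.2 u i)
        / MinSum.updateDenom G Γ q.1 i j)) t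
  obtain ⟨hden, hsum, hconv, hmin⟩ := hasync (fun _ => Set.univ) (fun _ _ t => t)
    (fun t => (p t).1) (fun t => (p t).2) _
    ⟨fun _ _ _ _ => le_rfl, fun _ => Set.infinite_univ,
      fun _ _ _ => tendsto_id.mono_left inf_le_left⟩ hp₀
    ⟨fun _ _ _ _ _ => rfl, fun _ _ _ _ _ => rfl,
      fun _ _ _ _ ht => absurd (Set.mem_univ _) ht⟩ (fun _ _ => rfl)
  have hden' : ∀ t i j, G.Adj i j → 0 < MinSum.updateDenom G Γ (p t).1 i j :=
    fun t i j hij => hden t i j hij (Set.mem_univ t)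
  have hparam : ∀ t, MinSum.HasParameters G Γ h (D.iterates G κv κe t) (p t).1 (p t).2 := by
    intro t
    induction t with
    | zero => exact hp₀
    | succ t ih => exact ih.step hsymm (hden' t) (κv t) (κe t)
  exact ⟨fun t => (hparam t).wellPosed hsymm (hden' t), _, _, _, hparam,
    fun t j y hy => (hparam t).vertex_lt (hsum t j) hy, hconv, hmin⟩
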